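/- Let $S=\{x_1,\dots,x_n\}\subset\mathbb{R}^2$ be a finite set of $n$ distinct points. For $i<j$ let the Gabriel circle of $x_i,x_j$ be the circle with diameter $\overline{x_ix_j}$, and let $D_{ij}$ be the closed disk that it bounds. The depth of $q\in\mathbb{R}^2$ is the proportion of these disks that contain $q$, $$\mathrm{SkD}_1(q;S)=\frac{1}{\binom n2}\sum_{1\le i<j\le n}\mathbf 1[q\in D_{ij}].$$ In the arrangement of the Gabriel circles of $S$, the vertices are the points of $S$ and the points that lie on two distinct Gabriel circles; the edges are the connected components of the Gabriel circles with the vertices removed; and the faces are the connected components of the complement of the union of all Gabriel circles. An edge of a face $A$ is an edge of the arrangement contained in the boundary of $A$. It is concave (for $A$) if it bends into $A$, that is, if the open segment joining any two distinct points of the edge is disjoint from $A$. Two distinct faces are neighbours if they have a common edge. A face $A$ is locally deepest if $\mathrm{SkD}_1(a;S)>\mathrm{SkD}_1(b;S)$ for every neighbour $B$ of $A$ and all $a\in A$, $b\in B$. Theorem. For every face $A$ of the arrangement of the Gabriel circles of $S$: (1) $A$ is locally deepest if and only if $A$ has no concave edge; (2) $A$ is locally deepest if and only if $A$ is a convex set.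 -/

import Mathlib

/-- The Euclidean plane. -/
abbrev Plane : Type := EuclideanSpace ℝ (Fin 2)

namespace Gabriel

/-- The Gabriel circle of `a` and `b`: the circle with diameter `ab`. -/
def circle (a b : Plane) : Set Plane :=
  Metric.sphere (midpoint ℝ a b) (dist a b / 2)

/-- The influence region of `a` and `b` (for `β = 1`): the closed disk with diameter `ab`. -/
def disk (a b : Plane) : Set Plane :=
  Metric.closedBall (midpoint ℝ a b) (dist a b / 2)

/-- The spherical depth (`β`-skeleton depth with `β = 1`) of `q`: the proportion of pairs
`i < j` such that the closed disk with diameter `x i`, `x j` contains `q`. -/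
noncomputable def depth {n : ℕ} (x : Fin n → Plane) (q : Plane) : ℝ :=
  1 / (n.choose 2 : ℝ) *
    ∑ i, ∑ j ∈ Finset.Ioi i, (disk (x i) (x j)).indicator (fun _ => (1 : ℝ)) q

/-- The set of all Gabriel circles of the data points. Circles obtained from several pairs occur
only once here. -/
def circles {n : ℕ} (x : Fin n → Plane) : Set (Set Plane) :=
  {C | ∃ i j : Fin n, i < j ∧ C = circle (x i) (x j)}

/-- The vertices of the arrangement: the data points, and the points that lie on two distinct
Gabriel circles. -/
def vertices {n : ℕ} (x : Fin n → Plane) : Set Plane :=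
  Set.range x ∪ {p | ∃ C ∈ circles x, ∃ C' ∈ circles x, C ≠ C' ∧ p ∈ C ∧ p ∈ C'}

/-- The edges of the arrangement: the connected components of a Gabriel circle with the vertices
removed. -/
def IsEdge {n : ℕ} (x : Fin n → Plane) (e : Set Plane) : Prop :=
  ∃ C ∈ circles x, ∃ p ∈ C \ vertices x, e = connectedComponentIn (C \ vertices x) p

/-- The faces of the arrangement: the connected components of the complement of the union of all
Gabriel circles. -/
def IsFace {n : ℕ} (x : Fin n → Plane) (A : Set Plane) : Prop :=
  ∃ q ∈ (⋃₀ circles x)ᶜ, A = connectedComponentIn (⋃₀ circles x)ᶜ q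

/-- `e` is an edge of the face `A`: an edge of the arrangement in the boundary of `A`. -/
def IsEdgeOf {n : ℕ} (x : Fin n → Plane) (e A : Set Plane) : Prop :=
  IsEdge x e ∧ e ⊆ frontier A

/-- `e` is a concave edge of the face `A`: it is an edge of `A` that bends into `A`, that is, the
chords of the arc `e` lie outside `A`. -/
def IsConcaveEdgeOf {n : ℕ} (x : Fin n → Plane) (e A : Set Plane) : Prop :=
  IsEdgeOf x e A ∧ ∀ y ∈ e, ∀ z ∈ e, y ≠ z → Disjoint (openSegment ℝ y z) A

/-- Two faces are neighbors if they are distinct and have a common edge in their boundaries. -/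
def AreNeighbors {n : ℕ} (x : Fin n → Plane) (A B : Set Plane) : Prop :=
  IsFace x A ∧ IsFace x B ∧ A ≠ B ∧ ∃ e, IsEdgeOf x e A ∧ IsEdgeOf x e B

/-- The face `A` is locally deepest: it is strictly deeper than every neighboring face. -/
def IsLocallyDeepest {n : ℕ} (x : Fin n → Plane) (A : Set Plane) : Prop :=
  ∀ B, AreNeighbors x A B → ∀ a ∈ A, ∀ b ∈ B, depth x b < depth x a

end Gabriel

namespace Gabriel

open Metric Set Topology

/-! ### Spheres and their radial neighbourhoods -/

/-! Near a non-vertex point of a Gabriel circle the arrangement is that circle alone, and each of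
its two sides lies in one face (`exists_ball_sides`). Crossing there from inside to outside leaves
every disk with another boundary circle unaffected, so the depth strictly drops (`depth_lt_depth`).
Chords of an arc lie inside its circle, so an edge of `A` is concave exactly when `A` lies outside
the circle of that edge. Thus local deepest and absence of concave edges both say that `A` lies
inside every circle carrying one of its edges.

For convexity, let `K` be the intersection of the open disks containing `A`. Without concave edges,
only vertices can be points of `closure A ∩ K` on a circle. Finitely many points do not disconnect a
small disk, so even these cannot occur: `A` is clopen in the connected set `K`, hence `A = K`.
Conversely, the closure of a convex face would contain the chords of a concave edge, which enter a
disk that the face avoids. -/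

/-- Sets described by the distance to a centre are locally connected around points off the
centre. -/
theorem exists_isPreconnected_radial {c p : Plane} (hp : 0 < dist p c) {ε : ℝ} (hε : 0 < ε)
    {J : Set ℝ} (hJ : J.OrdConnected) :
    ∃ δ > 0, ∃ W : Set Plane, IsPreconnected W ∧
      ball p δ ∩ {q | dist q c ∈ J} ⊆ W ∧ W ⊆ ball p ε ∩ {q | dist q c ∈ J} := by
  set r := dist p c with hr
  have hpc : ‖p - c‖ = r := by rw [hr, dist_eq_norm]
  -- Below, `f` moves points by less than `2 * η`, so `3 * η ≤ ε` keeps the image in `ball p ε`; `η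
  -- ≤ r` keeps the centre out of `ball p η`.
  set η := min (ε / 3) r with hη
  have hη0 : 0 < η := lt_min (by linarith) hp
  have hηε : 3 * η ≤ ε := by
    have := min_le_left (ε / 3) r
    linarith
  have hηr : η ≤ r := min_le_right _ _
  -- Slide `z.1` along its ray from `c` to distance `z.2`: the image of ball times interval is
  -- connected.
  let f : Plane × ℝ → Plane := fun z => c + (z.2 / ‖z.1 - c‖) • (z.1 - c)
  let T : Set ℝ := Ioo (r - η) (r + η) ∩ J
  have hpos : ∀ q ∈ ball p η, 0 < ‖q - c‖ := by
    intro q hq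
    have h1 : dist p c ≤ dist p q + dist q c := dist_triangle _ _ _
    rw [mem_ball, dist_comm] at hq
    rw [← dist_eq_norm]
    linarith
  have hclose : ∀ q ∈ ball p η, |‖q - c‖ - r| < η := by
    intro q hq
    have h1 := abs_norm_sub_norm_le (q - c) (p - c)
    rw [hpc, sub_sub_sub_cancel_right, ← dist_eq_norm] at h1
    exact h1.trans_lt hq
  have hT : IsPreconnected T := (ordConnected_Ioo.inter hJ).isPreconnected
  have hcont : ContinuousOn f (ball p η ×ˢ T) := by
    have h0 : ∀ z ∈ ball p η ×ˢ T, ‖z.1 - c‖ ≠ 0 := fun z hz => (hpos z.1 hz.1).ne'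
    have h1 : ContinuousOn (fun z : Plane × ℝ => z.2 / ‖z.1 - c‖) (ball p η ×ˢ T) :=
      continuous_snd.continuousOn.div (by fun_prop) h0
    exact continuousOn_const.add (h1.smul (by fun_prop))
  refine ⟨η, hη0, f '' (ball p η ×ˢ T),
    (isPreconnected_ball.prod hT).image f hcont, ?_, ?_⟩
  · rintro q ⟨hq, hqJ⟩
    have h1 := abs_lt.1 (hclose q hq)
    refine ⟨(q, dist q c), ⟨hq, ⟨?_, ?_⟩, hqJ⟩, ?_⟩
    · simp only [dist_eq_norm]; linarith
    · simp only [dist_eq_norm]; linarith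
    · simp [f, dist_eq_norm, div_self (hpos q hq).ne']
  · rintro _ ⟨⟨q, t⟩, ⟨hq, ht, htJ⟩, rfl⟩
    dsimp only at hq ht htJ
    have h0 := hpos q hq
    have h1 := abs_lt.1 (hclose q hq)
    have ht0 : 0 < t := by linarith [ht.1]
    have hf : f (q, t) - q = ((t - ‖q - c‖) / ‖q - c‖) • (q - c) := by
      simp only [f]
      rw [sub_div, div_self h0.ne', sub_smul, one_smul]
      abel
    constructor
    · have h2 : dist (f (q, t)) q < 2 * η := by
        rw [dist_eq_norm, hf, norm_smul, norm_div, norm_norm, div_mul_cancel₀ _ h0.ne',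
          Real.norm_eq_abs, abs_lt]
        constructor <;> linarith [ht.1, ht.2]
      have h3 := dist_triangle (f (q, t)) q p
      rw [mem_ball] at hq ⊢
      linarith
    · have : dist (f (q, t)) c = t := by
        rw [dist_eq_norm]
        simp only [f]
        rw [add_sub_cancel_left, norm_smul, norm_div, norm_norm, div_mul_cancel₀ _ h0.ne',
          Real.norm_of_nonneg ht0.le]
      rw [mem_ofPred_eq, this]
      exact htJ

theorem one_lt_rank_plane : 1 < Module.rank ℝ Plane := by
  rw [← Module.finrank_eq_rank, finrank_euclideanSpace_fin]
  norm_num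

/-- Points of a circle are not isolated in it, even after finitely many points are removed. -/
theorem exists_mem_sphere_near {c p : Plane} {r : ℝ} (hr : 0 < r) (hp : p ∈ sphere c r)
    {ε : ℝ} (hε : 0 < ε) {F : Set Plane} (hF : F.Finite) :
    ∃ z ∈ ball p ε, z ∈ sphere c r ∧ z ∉ F ∧ z ≠ p := by
  have hnt : (sphere c r).Nontrivial := by
    refine ⟨p, hp, c - (p - c), ?_, ?_⟩
    · rw [mem_sphere, dist_eq_norm] at hp ⊢
      rw [sub_sub_cancel_left, norm_neg, hp]
    · intro h
      have h2 : p - c = 0 := by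
        have h3 : p - c = -(p - c) := by
          nth_rewrite 1 [h]
          abel
        have h4 : (2 : ℝ) • (p - c) = 0 := by rw [two_smul, add_eq_zero_iff_eq_neg.2 h3]
        exact (smul_eq_zero.1 h4).resolve_left two_ne_zero
      rw [mem_sphere, dist_eq_norm, h2, norm_zero] at hp
      exact hr.ne hp
  have hacc := (isPreconnected_sphere one_lt_rank_plane c r).preperfect_of_nontrivial hnt p hp
  rw [accPt_iff_nhds] at hacc
  -- `p` may belong to `F`, so it is deleted first to make the complement a neighbourhood of `p`.
  have hFc : (F \ {p})ᶜ ∈ 𝓝 p := (hF.subset sdiff_subset).isClosed.isOpen_compl.mem_nhds (by simp)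
  obtain ⟨z, ⟨⟨hz1, hz2⟩, hz3⟩, hz4⟩ := hacc _ (Filter.inter_mem (ball_mem_nhds p hε) hFc)
  exact ⟨z, hz1, hz3, fun h => hz2 ⟨h, hz4⟩, hz4⟩

theorem finite_inter_sphere {c c' : Plane} {r r' : ℝ} (h : sphere c r ≠ sphere c' r') :
    (sphere c r ∩ sphere c' r').Finite := by
  by_cases hc : c = c'
  · subst hc
    have : sphere c r ∩ sphere c r' = ∅ := by
      refine eq_empty_of_forall_notMem fun q hq => h ?_
      rw [← mem_sphere.1 hq.1, ← mem_sphere.1 hq.2]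
    rw [this]
    exact finite_empty
  -- Circles with distinct centres cannot share three points.
  · by_contra hinf
    obtain ⟨t, ht, htc⟩ := Set.Infinite.exists_subset_card_eq hinf 3
    obtain ⟨p, q, s, hpq, hps, hqs, rfl⟩ := Finset.card_eq_three.1 htc
    have hp := ht (show p ∈ _ by simp)
    have hq := ht (show q ∈ _ by simp)
    have hs := ht (show s ∈ _ by simp)
    rcases EuclideanGeometry.eq_of_dist_eq_of_dist_eq_of_finrank_eq_two
      (finrank_euclideanSpace_fin) hc hpq hp.1 hq.1 hs.1 hp.2 hq.2 hs.2 with h1 | h1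
    · exact hps h1.symm
    · exact hqs h1.symm

theorem isPreconnected_ball_diff_countable (p : Plane) {ε : ℝ} (hε : 0 < ε) {F : Set Plane}
    (hF : F.Countable) : IsPreconnected (ball p ε \ F) := by
  -- The disk is a homeomorphic copy of the plane, where complements of countable sets are
  -- connected.
  let φ := OpenPartialHomeomorph.univBall p ε
  have hinj : Function.Injective φ := by
    rw [← injOn_univ, ← OpenPartialHomeomorph.univBall_source p ε]
    exact φ.injOn
  have hcont : Continuous φ := OpenPartialHomeomorph.continuous_univBall p ε
  have himg : φ '' (φ ⁻¹' F)ᶜ = ball p ε \ F := by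
    have h1 : φ '' univ = ball p ε := by
      rw [← OpenPartialHomeomorph.univBall_source p ε, φ.image_source_eq_target,
        OpenPartialHomeomorph.univBall_target p hε]
    ext q
    rw [← h1]
    constructor
    · rintro ⟨y, hy, rfl⟩
      exact ⟨⟨y, mem_univ _, rfl⟩, hy⟩
    · rintro ⟨⟨y, -, rfl⟩, hq⟩
      exact ⟨y, hq, rfl⟩
  rw [← himg]
  exact ((hF.preimage_of_injOn hinj.injOn).isConnected_compl_of_one_lt_rank
    one_lt_rank_plane).isPreconnected.image _ hcont.continuousOn

/-! ### The arrangement -/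

variable {n : ℕ} {x : Fin n → Plane}

theorem finite_circles (x : Fin n → Plane) : (circles x).Finite := by
  refine (finite_range fun k : Fin n × Fin n => circle (x k.1) (x k.2)).subset ?_
  rintro C ⟨i, j, -, rfl⟩
  exact ⟨(i, j), rfl⟩

theorem exists_eq_sphere (hx : Function.Injective x) {C : Set Plane} (hC : C ∈ circles x) :
    ∃ c : Plane, ∃ r : ℝ, 0 < r ∧ C = sphere c r := by
  obtain ⟨i, j, hij, rfl⟩ := hC
  exact ⟨_, _, half_pos (dist_pos.2 (hx.ne hij.ne)), rfl⟩

theorem isClosed_of_mem_circles {C : Set Plane} (hC : C ∈ circles x) : IsClosed C := by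
  obtain ⟨i, j, -, rfl⟩ := hC
  exact isClosed_sphere

theorem isClosed_sUnion_of_subset_circles {T : Set (Set Plane)} (hT : T ⊆ circles x) :
    IsClosed (⋃₀ T) := by
  rw [sUnion_eq_biUnion]
  exact ((finite_circles x).subset hT).isClosed_biUnion fun _ h => isClosed_of_mem_circles (hT h)

theorem isOpen_compl_sUnion_circles (x : Fin n → Plane) : IsOpen (⋃₀ circles x)ᶜ :=
  (isClosed_sUnion_of_subset_circles Subset.rfl).isOpen_compl

theorem finite_vertices (x : Fin n → Plane) : (vertices x).Finite := by
  refine (finite_range x).union ?_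
  have : {p | ∃ C ∈ circles x, ∃ C' ∈ circles x, C ≠ C' ∧ p ∈ C ∧ p ∈ C'} ⊆
      ⋃ C ∈ circles x, ⋃ C' ∈ {C' ∈ circles x | C ≠ C'}, C ∩ C' := by
    rintro p ⟨C, hC, C', hC', hne, hp, hp'⟩
    exact mem_biUnion hC (mem_biUnion (show C' ∈ {C' ∈ circles x | C ≠ C'} from ⟨hC', hne⟩)
      ⟨hp, hp'⟩)
  refine Finite.subset ?_ this
  refine (finite_circles x).biUnion fun C hC =>
    ((finite_circles x).subset (sep_subset _ _)).biUnion fun C' hC' => ?_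
  obtain ⟨i, j, -, rfl⟩ := hC
  obtain ⟨⟨k, l, -, rfl⟩, hne⟩ := hC'
  exact finite_inter_sphere hne

/-- Near a point of a circle that is not a vertex, the arrangement consists of this circle. -/
theorem exists_ball_inter_circles_subset {C : Set Plane} (hC : C ∈ circles x) {p : Plane}
    (hp : p ∈ C \ vertices x) : ∃ ε > 0, ball p ε ∩ ⋃₀ circles x ⊆ C := by
  have hcl : IsClosed (⋃₀ (circles x \ {C})) :=
    isClosed_sUnion_of_subset_circles sdiff_subset
  have hpn : p ∉ ⋃₀ (circles x \ {C}) := by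
    rintro ⟨C', ⟨hC', hne⟩, hpC'⟩
    exact hp.2 (Or.inr ⟨C', hC', C, hC, hne, hpC', hp.1⟩)
  obtain ⟨ε, hε, hsub⟩ := Metric.isOpen_iff.1 hcl.isOpen_compl p hpn
  refine ⟨ε, hε, ?_⟩
  rintro q ⟨hq, C', hC', hqC'⟩
  by_contra hqC
  exact hsub hq ⟨C', ⟨hC', fun h => hqC (h ▸ hqC')⟩, hqC'⟩

theorem IsFace.isPreconnected {A : Set Plane} (hA : IsFace x A) : IsPreconnected A := by
  obtain ⟨q, -, rfl⟩ := hA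
  exact isPreconnected_connectedComponentIn

theorem IsFace.subset_compl {A : Set Plane} (hA : IsFace x A) : A ⊆ (⋃₀ circles x)ᶜ := by
  obtain ⟨q, -, rfl⟩ := hA
  exact connectedComponentIn_subset _ _

theorem IsFace.nonempty {A : Set Plane} (hA : IsFace x A) : A.Nonempty := by
  obtain ⟨q, hq, rfl⟩ := hA
  exact ⟨q, mem_connectedComponentIn hq⟩

theorem IsFace.isOpen {A : Set Plane} (hA : IsFace x A) : IsOpen A := by
  obtain ⟨q, -, rfl⟩ := hA
  exact (isOpen_compl_sUnion_circles x).connectedComponentIn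

theorem IsFace.subset_of_isPreconnected {A W : Set Plane} (hA : IsFace x A)
    (hW : IsPreconnected W) (hWU : W ⊆ (⋃₀ circles x)ᶜ) (h : (W ∩ A).Nonempty) : W ⊆ A := by
  obtain ⟨q, -, rfl⟩ := hA
  obtain ⟨y, hyW, hyA⟩ := h
  rw [connectedComponentIn_eq hyA]
  exact hW.subset_connectedComponentIn hyW hWU

theorem IsFace.eq_of_inter_nonempty {A B : Set Plane} (hA : IsFace x A) (hB : IsFace x B)
    (h : (A ∩ B).Nonempty) : A = B :=
  (hB.subset_of_isPreconnected hA.isPreconnected hA.subset_compl h).antisymm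
    (hA.subset_of_isPreconnected hB.isPreconnected hB.subset_compl (inter_comm A B ▸ h))

theorem IsFace.mem_of_mem_closure {A : Set Plane} (hA : IsFace x A) {q : Plane}
    (hq : q ∈ closure A) (hqU : q ∈ (⋃₀ circles x)ᶜ) : q ∈ A := by
  obtain ⟨ε, hε, hsub⟩ := Metric.isOpen_iff.1 (isOpen_compl_sUnion_circles x) q hqU
  refine hA.subset_of_isPreconnected isPreconnected_ball hsub ?_ (mem_ball_self hε)
  exact mem_closure_iff.1 hq _ isOpen_ball (mem_ball_self hε)

/-- A face lies on one side of every circle of the arrangement. -/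
theorem IsFace.subset_ball_or {A : Set Plane} (hA : IsFace x A) {c : Plane} {r : ℝ}
    (hC : sphere c r ∈ circles x) : A ⊆ ball c r ∨ A ⊆ (closedBall c r)ᶜ := by
  refine hA.isPreconnected.subset_or_subset isOpen_ball isClosed_closedBall.isOpen_compl ?_ ?_
  · exact disjoint_compl_right_iff_subset.2 ball_subset_closedBall
  · intro q hq
    have h1 : dist q c ≠ r := fun h => hA.subset_compl hq ⟨_, hC, h⟩
    rcases h1.lt_or_gt with h | h
    · exact Or.inl h
    · exact Or.inr (not_le.2 h)

/-- Near a point of a circle that is not a vertex, every face that meets a side of the circle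
contains this side. -/
theorem exists_ball_sides {c p : Plane} {r : ℝ} (hr : 0 < r) (hC : sphere c r ∈ circles x)
    (hp : p ∈ sphere c r \ vertices x) :
    ∃ δ > 0, ball p δ ∩ ball c r ⊆ (⋃₀ circles x)ᶜ ∧ ∀ A, IsFace x A →
      ((ball p δ ∩ ball c r ∩ A).Nonempty → ball p δ ∩ ball c r ⊆ A) ∧
      ((ball p δ ∩ (closedBall c r)ᶜ ∩ A).Nonempty → ball p δ ∩ (closedBall c r)ᶜ ⊆ A) := by
  obtain ⟨ε, hε, hsub⟩ := exists_ball_inter_circles_subset hC hp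
  have hpc : dist p c = r := hp.1
  have hpc0 : 0 < dist p c := hpc ▸ hr
  have hJ1 : {q : Plane | dist q c ∈ Iio r} = ball c r := rfl
  have hJ2 : {q : Plane | dist q c ∈ Ioi r} = (closedBall c r)ᶜ := by
    ext q
    simp
  obtain ⟨δ₁, hδ₁, W₁, hW₁, hs₁, ht₁⟩ :=
    exists_isPreconnected_radial hpc0 hε (ordConnected_Iio (a := r))
  obtain ⟨δ₂, hδ₂, W₂, hW₂, hs₂, ht₂⟩ :=
    exists_isPreconnected_radial hpc0 hε (ordConnected_Ioi (a := r))
  rw [hJ1] at hs₁ ht₁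
  rw [hJ2] at hs₂ ht₂
  have hU₁ : W₁ ⊆ (⋃₀ circles x)ᶜ := fun q hq h =>
    (mem_ball.1 (ht₁ hq).2).ne (hsub ⟨(ht₁ hq).1, h⟩)
  have hU₂ : W₂ ⊆ (⋃₀ circles x)ᶜ := fun q hq h =>
    (ht₂ hq).2 (sphere_subset_closedBall (hsub ⟨(ht₂ hq).1, h⟩))
  have h1 : ball p (min δ₁ δ₂) ∩ ball c r ⊆ W₁ :=
    (inter_subset_inter_left _ (ball_subset_ball (min_le_left _ _))).trans hs₁
  have h2 : ball p (min δ₁ δ₂) ∩ (closedBall c r)ᶜ ⊆ W₂ :=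
    (inter_subset_inter_left _ (ball_subset_ball (min_le_right _ _))).trans hs₂
  exact ⟨min δ₁ δ₂, lt_min hδ₁ hδ₂, h1.trans hU₁, fun A hA =>
    ⟨fun h => h1.trans (hA.subset_of_isPreconnected hW₁ hU₁ (h.mono (inter_subset_inter_left _ h1))),
     fun h => h2.trans (hA.subset_of_isPreconnected hW₂ hU₂ (h.mono (inter_subset_inter_left _ h2)))⟩⟩

theorem mem_closure_of_subset_ball {c p : Plane} {r : ℝ} (hr : 0 < r) {δ : ℝ} (hδ : 0 < δ)
    (hp : p ∈ sphere c r) {A : Set Plane} (h : ball p δ ∩ ball c r ⊆ A) : p ∈ closure A := by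
  refine closure_mono h ?_
  rw [mem_closure_iff_nhds]
  intro t ht
  have h1 : p ∈ closure (ball c r) := by
    rw [closure_ball c hr.ne']
    exact sphere_subset_closedBall hp
  obtain ⟨q, ⟨hq1, hq2⟩, hq3⟩ :=
    mem_closure_iff_nhds.1 h1 _ (Filter.inter_mem ht (ball_mem_nhds p hδ))
  exact ⟨q, hq1, hq2, hq3⟩

theorem mem_closure_compl_closedBall {c p : Plane} {r : ℝ} (hr : 0 < r)
    (hp : p ∈ sphere c r) : p ∈ closure (closedBall c r)ᶜ := by
  rw [closure_compl, interior_closedBall c hr.ne']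
  exact fun h => (mem_ball.1 h).ne hp

theorem mem_closure_of_subset_compl {c p : Plane} {r : ℝ} (hr : 0 < r) {δ : ℝ} (hδ : 0 < δ)
    (hp : p ∈ sphere c r) {A : Set Plane} (h : ball p δ ∩ (closedBall c r)ᶜ ⊆ A) :
    p ∈ closure A := by
  refine closure_mono h ?_
  rw [mem_closure_iff_nhds]
  intro t ht
  obtain ⟨q, ⟨hq1, hq2⟩, hq3⟩ := mem_closure_iff_nhds.1 (mem_closure_compl_closedBall hr hp) _
    (Filter.inter_mem ht (ball_mem_nhds p hδ))
  exact ⟨q, hq1, hq2, hq3⟩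

/-- An edge one point of which lies in the closure of a face is an edge of this face. -/
theorem IsFace.edge_subset_frontier (hx : Function.Injective x) {A : Set Plane}
    (hA : IsFace x A) {C : Set Plane} (hC : C ∈ circles x) {e : Set Plane}
    (he : IsPreconnected e) (heC : e ⊆ C \ vertices x) {p : Plane} (hpe : p ∈ e)
    (hpA : p ∈ closure A) : e ⊆ frontier A := by
  obtain ⟨c, r, hr, rfl⟩ := exists_eq_sphere hx hC
  -- This makes `e ∩ closure A` open in `e`; being closed too, it is all of the connected set `e`.
  have hloc : ∀ p ∈ e ∩ closure A, ∃ δ > 0, ball p δ ∩ sphere c r ⊆ closure A := by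
    rintro p ⟨hpe, hpA⟩
    obtain ⟨δ, hδ, -, hside⟩ := exists_ball_sides hr hC (heC hpe)
    obtain ⟨y, hyb, hyA⟩ := mem_closure_iff.1 hpA _ isOpen_ball (mem_ball_self hδ)
    refine ⟨δ, hδ, ?_⟩
    rintro q ⟨hqb, hq⟩
    obtain ⟨η, hη, hsub⟩ := Metric.isOpen_iff.1 isOpen_ball q hqb
    rcases hA.subset_ball_or hC with h | h
    · exact mem_closure_of_subset_ball hr hη hq
        ((inter_subset_inter_left _ hsub).trans ((hside A hA).1 ⟨y, ⟨hyb, h hyA⟩, hyA⟩))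
    · exact mem_closure_of_subset_compl hr hη hq
        ((inter_subset_inter_left _ hsub).trans ((hside A hA).2 ⟨y, ⟨hyb, h hyA⟩, hyA⟩))
  choose! δ hδ hδA using hloc
  have hecl : e ⊆ closure A := by
    by_contra hne
    obtain ⟨q, hqe, hqA⟩ := not_subset.1 hne
    obtain ⟨z, hze, hz1, hz2⟩ := he (⋃ p ∈ e ∩ closure A, ball p (δ p)) (closure A)ᶜ
      (isOpen_biUnion fun _ _ => isOpen_ball) isClosed_closure.isOpen_compl
      (fun q hq => by
        by_cases hqA : q ∈ closure A
        · exact Or.inl (mem_biUnion (mem_inter hq hqA) (mem_ball_self (hδ q ⟨hq, hqA⟩)))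
        · exact Or.inr hqA)
      ⟨p, hpe, mem_biUnion (mem_inter hpe hpA) (mem_ball_self (hδ p ⟨hpe, hpA⟩))⟩ ⟨q, hqe, hqA⟩
    simp only [mem_iUnion] at hz1
    obtain ⟨y, hy, hzy⟩ := hz1
    exact hz2 (hδA y hy ⟨hzy, (heC hze).1⟩)
  intro q hq
  rw [hA.isOpen.frontier_eq]
  exact ⟨hecl hq, fun hqA => hA.subset_compl hqA ⟨_, hC, (heC hq).1⟩⟩

/-- Supplies arbitrarily short chords of an edge at any of its points. -/
theorem exists_mem_edge_near (hx : Function.Injective x) {C : Set Plane} (hC : C ∈ circles x)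
    {p : Plane} (hp : p ∈ C \ vertices x) {δ : ℝ} (hδ : 0 < δ) :
    ∃ z ∈ ball p δ, z ∈ connectedComponentIn (C \ vertices x) p ∧ z ≠ p := by
  obtain ⟨c, r, hr, rfl⟩ := exists_eq_sphere hx hC
  obtain ⟨ε, hε, hsub⟩ :=
    Metric.isOpen_iff.1 (finite_vertices x).isClosed.isOpen_compl p hp.2
  have hpc0 : 0 < dist p c := by rw [mem_sphere.1 hp.1]; exact hr
  -- With `J = {r}` the radial set is a piece of the circle itself.
  obtain ⟨η, hη, W, hW, hs, ht⟩ :=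
    exists_isPreconnected_radial hpc0 hε (ordConnected_singleton (a := r))
  obtain ⟨z, hz, hzs, -, hzp⟩ := exists_mem_sphere_near hr hp.1 (lt_min hη hδ) finite_empty
  refine ⟨z, ball_subset_ball (min_le_right _ _) hz, ?_, hzp⟩
  have hWC : W ⊆ sphere c r \ vertices x := fun q hq => ⟨(ht hq).2, hsub (ht hq).1⟩
  exact hW.subset_connectedComponentIn (hs ⟨mem_ball_self hη, hp.1⟩) hWC
    (hs ⟨ball_subset_ball (min_le_left _ _) hz, hzs⟩)

/-! ### Concave edges -/

theorem isConcaveEdgeOf_of_subset_compl {A : Set Plane} {c : Plane} {r : ℝ}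
    {e : Set Plane} (he : IsEdgeOf x e A) (hes : e ⊆ sphere c r) (hA : A ⊆ (closedBall c r)ᶜ) :
    IsConcaveEdgeOf x e A := by
  refine ⟨he, fun y hy z hz hyz => disjoint_left.2 fun q hq hqA => hA hqA ?_⟩
  exact ball_subset_closedBall (openSegment_subset_ball_of_ne
    (sphere_subset_closedBall (hes hy)) (sphere_subset_closedBall (hes hz)) hyz hq)

theorem midpoint_mem_ball_of_mem_sphere {c p z : Plane} {r : ℝ} (hp : p ∈ sphere c r)
    (hz : z ∈ sphere c r) (hpz : p ≠ z) : midpoint ℝ p z ∈ ball c r :=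
  openSegment_subset_ball_of_ne (sphere_subset_closedBall hp) (sphere_subset_closedBall hz) hpz
    (midpoint_mem_openSegment p z)

/-- A concave edge of a face lies on a circle that does not enclose the face. -/
theorem IsConcaveEdgeOf.subset_compl (hx : Function.Injective x) {A : Set Plane}
    (hA : IsFace x A) {c p : Plane} {r : ℝ} (hr : 0 < r) (hC : sphere c r ∈ circles x)
    (hp : p ∈ sphere c r \ vertices x)
    (he : IsConcaveEdgeOf x (connectedComponentIn (sphere c r \ vertices x) p) A) :
    A ⊆ (closedBall c r)ᶜ := by
  refine (hA.subset_ball_or hC).resolve_left fun hball => ?_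
  have hpe := mem_connectedComponentIn hp
  obtain ⟨δ, hδ, -, hside⟩ := exists_ball_sides hr hC hp
  obtain ⟨y, hyb, hyA⟩ := mem_closure_iff.1 (frontier_subset_closure (he.1.2 hpe)) _ isOpen_ball
    (mem_ball_self hδ)
  have hsub := (hside A hA).1 ⟨y, ⟨hyb, hball hyA⟩, hyA⟩
  -- A short chord at `p` runs on the inner side, which belongs to `A`, against concavity.
  obtain ⟨z, hzb, hze, hzp⟩ := exists_mem_edge_near hx hC hp hδ
  have hzs := (connectedComponentIn_subset _ _ hze).1
  refine disjoint_left.1 (he.2 p hpe z hze hzp.symm) (midpoint_mem_openSegment p z) (hsub ⟨?_, ?_⟩)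
  · exact (convex_ball p δ).openSegment_subset (mem_ball_self hδ) hzb
      (midpoint_mem_openSegment p z)
  · exact midpoint_mem_ball_of_mem_sphere hp.1 hzs hzp.symm

theorem not_exists_isConcaveEdgeOf_of_convex (hx : Function.Injective x) {A : Set Plane}
    (hA : IsFace x A) (hconv : Convex ℝ A) : ¬ ∃ e, IsConcaveEdgeOf x e A := by
  rintro ⟨e, he⟩
  obtain ⟨C, hC, p, hp, rfl⟩ := he.1.1
  obtain ⟨c, r, hr, rfl⟩ := exists_eq_sphere hx hC
  have hout := he.subset_compl hx hA hr hC hp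
  obtain ⟨z, -, hze, hzp⟩ := exists_mem_edge_near hx hC hp one_pos
  have hcl := he.1.2.trans frontier_subset_closure
  have hm : midpoint ℝ p z ∈ closure A :=
    hconv.closure.openSegment_subset (hcl (mem_connectedComponentIn hp)) (hcl hze)
      (midpoint_mem_openSegment p z)
  obtain ⟨y, hyb, hyA⟩ := mem_closure_iff.1 hm _ isOpen_ball
    (midpoint_mem_ball_of_mem_sphere hp.1 (connectedComponentIn_subset _ _ hze).1 hzp.symm)
  exact hout hyA (ball_subset_closedBall hyb)

/-- A face without concave edges is the intersection of the open disks that contain it. -/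
theorem convex_of_not_exists_isConcaveEdgeOf (hx : Function.Injective x) {A : Set Plane}
    (hA : IsFace x A) (hno : ¬ ∃ e, IsConcaveEdgeOf x e A) : Convex ℝ A := by
  let S : Set (Fin n × Fin n) :=
    {k | A ⊆ ball (midpoint ℝ (x k.1) (x k.2)) (dist (x k.1) (x k.2) / 2)}
  let K : Set Plane := ⋂ k ∈ S, ball (midpoint ℝ (x k.1) (x k.2)) (dist (x k.1) (x k.2) / 2)
  have hKconv : Convex ℝ K := convex_iInter₂ fun _ _ => convex_ball _ _
  have hKopen : IsOpen K := (toFinite S).isOpen_biInter fun _ _ => isOpen_ball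
  have hAK : A ⊆ K := subset_iInter₂ fun _ hk => hk
  have hvert : ∀ q ∈ closure A ∩ K, q ∈ ⋃₀ circles x → q ∈ vertices x := by
    rintro q ⟨hqA, hqK⟩ ⟨C, hC, hqC⟩
    by_contra hqV
    have hq : q ∈ C \ vertices x := ⟨hqC, hqV⟩
    have he : IsEdgeOf x (connectedComponentIn (C \ vertices x) q) A :=
      ⟨⟨C, hC, q, hq, rfl⟩, hA.edge_subset_frontier hx hC isPreconnected_connectedComponentIn
        (connectedComponentIn_subset _ _) (mem_connectedComponentIn hq) hqA⟩
    have hsub : connectedComponentIn (C \ vertices x) q ⊆ C :=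
      (connectedComponentIn_subset _ _).trans sdiff_subset
    obtain ⟨i, j, hij, rfl⟩ := hC
    rcases hA.subset_ball_or ⟨i, j, hij, rfl⟩ with h | h
    · exact (mem_ball.1 (mem_iInter₂.1 hqK (i, j) h)).ne hqC
    · exact hno ⟨_, isConcaveEdgeOf_of_subset_compl he hsub h⟩
  have hclosed : closure A ∩ K ⊆ A := by
    rintro p ⟨hpA, hpK⟩
    refine hA.mem_of_mem_closure hpA ?_
    rintro ⟨C, hC, hpC⟩
    obtain ⟨ε, hε, hεK⟩ := Metric.isOpen_iff.1 hKopen p hpK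
    let V := vertices x ∩ ⋃₀ circles x
    have hV : V.Finite := (finite_vertices x).subset inter_subset_left
    have hsub : ball p ε \ V ⊆ A := by
      refine (isPreconnected_ball_diff_countable p hε hV.countable).subset_of_closure_inter_subset
        hA.isOpen ?_ ?_
      · obtain ⟨y, hyb, hyA⟩ := mem_closure_iff.1 hpA _ isOpen_ball (mem_ball_self hε)
        exact ⟨y, ⟨hyb, fun h => hA.subset_compl hyA h.2⟩, hyA⟩
      · rintro q ⟨hqA, hqb, hqV⟩
        exact hA.mem_of_mem_closure hqA fun hqU => hqV ⟨hvert q ⟨hqA, hεK hqb⟩ hqU, hqU⟩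
    -- The circle through `p` has further points near `p` outside `V`; they would lie in `A`.
    obtain ⟨c, r, hr, rfl⟩ := exists_eq_sphere hx hC
    obtain ⟨z, hzb, hzs, hzV, -⟩ := exists_mem_sphere_near hr hpC hε hV
    exact hA.subset_compl (hsub ⟨hzb, hzV⟩) ⟨_, hC, hzs⟩
  have hKA : K ⊆ A := hKconv.isPreconnected.subset_of_closure_inter_subset hA.isOpen
    (hA.nonempty.mono fun q hq => ⟨hAK hq, hq⟩) hclosed
  rw [hAK.antisymm hKA]
  exact hKconv

/-! ### Depth -/

/-- Crossing an edge from the inside to the outside of its circle strictly decreases the depth. -/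
theorem depth_lt_depth {A B : Set Plane} (hA : IsFace x A)
    (hB : IsFace x B) {i₀ j₀ : Fin n} (hij₀ : i₀ < j₀) {p : Plane}
    (hp : p ∈ circle (x i₀) (x j₀) \ vertices x) (hpA : p ∈ closure A) (hpB : p ∈ closure B)
    (hAin : A ⊆ disk (x i₀) (x j₀)) (hBout : B ⊆ (disk (x i₀) (x j₀))ᶜ) {a b : Plane}
    (ha : a ∈ A) (hb : b ∈ B) : depth x b < depth x a := by
  have hkey : ∀ i j : Fin n, i < j → b ∈ disk (x i) (x j) → a ∈ disk (x i) (x j) := by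
    intro i j hij hbd
    -- Several pairs may share a circle; their disks then agree, as convex hulls of it.
    by_cases hC : circle (x i) (x j) = circle (x i₀) (x j₀)
    · have hd : disk (x i) (x j) = disk (x i₀) (x j₀) := by
        have h1 : ∀ u v : Plane, disk u v = convexHull ℝ (circle u v) := fun u v =>
          (convexHull_sphere_eq_closedBall _ (by positivity)).symm
        rw [h1, h1, hC]
      exact absurd (hd ▸ hbd) (hBout hb)
    · have hmem : circle (x i) (x j) ∈ circles x := ⟨i, j, hij, rfl⟩
      have hpn : p ∉ circle (x i) (x j) := fun h =>
        hp.2 (Or.inr ⟨_, hmem, _, ⟨i₀, j₀, hij₀, rfl⟩, hC, h, hp.1⟩)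
      have hBin := (hB.subset_ball_or hmem).resolve_right fun h => h hb hbd
      have hpin : p ∈ ball (midpoint ℝ (x i) (x j)) (dist (x i) (x j) / 2) := by
        have h2 := (closure_mono hBin).trans closure_ball_subset_closedBall hpB
        exact (mem_closedBall.1 h2).lt_of_ne hpn
      obtain ⟨y, hyb, hyA⟩ := mem_closure_iff.1 hpA _ isOpen_ball hpin
      have hAin := (hA.subset_ball_or hmem).resolve_right fun h =>
        h hyA (ball_subset_closedBall hyb)
      exact ball_subset_closedBall (hAin ha)
  have hterm : ∀ i j : Fin n, i < j → (disk (x i) (x j)).indicator (fun _ => (1 : ℝ)) b ≤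
      (disk (x i) (x j)).indicator (fun _ => (1 : ℝ)) a := by
    intro i j hij
    by_cases hbd : b ∈ disk (x i) (x j)
    · rw [indicator_of_mem hbd, indicator_of_mem (hkey i j hij hbd)]
    · rw [indicator_of_notMem hbd]
      exact indicator_nonneg (fun _ _ => zero_le_one) a
  have hn : 2 ≤ n := by
    have h1 := i₀.isLt
    have h2 := j₀.isLt
    have h3 : (i₀ : ℕ) < j₀ := hij₀
    omega
  have hpos : (0 : ℝ) < 1 / (n.choose 2 : ℝ) :=
    one_div_pos.2 (Nat.cast_pos.2 (Nat.choose_pos hn))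
  refine mul_lt_mul_of_pos_left ?_ hpos
  refine Finset.sum_lt_sum
    (fun i _ => Finset.sum_le_sum fun j hj => hterm i j (Finset.mem_Ioi.1 hj))
    ⟨i₀, Finset.mem_univ _, Finset.sum_lt_sum (fun j hj => hterm i₀ j (Finset.mem_Ioi.1 hj))
      ⟨j₀, Finset.mem_Ioi.2 hij₀, ?_⟩⟩
  rw [indicator_of_notMem (hBout hb), indicator_of_mem (hAin ha)]
  exact zero_lt_one

theorem isLocallyDeepest_of_not_exists_isConcaveEdgeOf (hx : Function.Injective x)
    {A : Set Plane} (hno : ¬ ∃ e, IsConcaveEdgeOf x e A) :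
    IsLocallyDeepest x A := by
  rintro B ⟨hA, hB, hne, e, heA, heB⟩ a ha b hb
  obtain ⟨C, hC, p, hp, rfl⟩ := heA.1
  have hpe := mem_connectedComponentIn hp
  have hpA := frontier_subset_closure (heA.2 hpe)
  have hpB := frontier_subset_closure (heB.2 hpe)
  have hsub : connectedComponentIn (C \ vertices x) p ⊆ C :=
    (connectedComponentIn_subset _ _).trans sdiff_subset
  obtain ⟨i, j, hij, rfl⟩ := hC
  have hC : circle (x i) (x j) ∈ circles x := ⟨i, j, hij, rfl⟩
  have hAin := (hA.subset_ball_or hC).resolve_right fun h =>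
    hno ⟨_, isConcaveEdgeOf_of_subset_compl heA hsub h⟩
  -- Were `B` inside as well, both faces would contain the inner side near `p` and coincide.
  have hBout := (hB.subset_ball_or hC).resolve_left fun hBin => by
    obtain ⟨δ, hδ, -, hside⟩ :=
      exists_ball_sides (half_pos (dist_pos.2 (hx.ne hij.ne))) hC hp
    obtain ⟨y, hyb, hyA⟩ := mem_closure_iff.1 hpA _ isOpen_ball (mem_ball_self hδ)
    obtain ⟨z, hzb, hzB⟩ := mem_closure_iff.1 hpB _ isOpen_ball (mem_ball_self hδ)
    have hzA := (hside A hA).1 ⟨y, ⟨hyb, hAin hyA⟩, hyA⟩ ⟨hzb, hBin hzB⟩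
    exact hne (hA.eq_of_inter_nonempty hB ⟨z, hzA, hzB⟩)
  exact depth_lt_depth hA hB hij hp hpA hpB (hAin.trans ball_subset_closedBall) hBout ha hb

theorem IsLocallyDeepest.not_exists_isConcaveEdgeOf (hx : Function.Injective x)
    {A : Set Plane} (hA : IsFace x A) (hdeep : IsLocallyDeepest x A) :
    ¬ ∃ e, IsConcaveEdgeOf x e A := by
  rintro ⟨e, he⟩
  obtain ⟨C, hC, p, hp, rfl⟩ := he.1.1
  obtain ⟨i, j, hij, rfl⟩ := hC
  have hr : 0 < dist (x i) (x j) / 2 := half_pos (dist_pos.2 (hx.ne hij.ne))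
  have hC : circle (x i) (x j) ∈ circles x := ⟨i, j, hij, rfl⟩
  have hAout := he.subset_compl hx hA hr hC hp
  have hpe := mem_connectedComponentIn hp
  obtain ⟨δ, hδ, hU, hside⟩ := exists_ball_sides hr hC hp
  obtain ⟨q, hqb, hqC⟩ := mem_closure_iff.1
    (mem_closure_of_subset_ball hr one_pos hp.1 inter_subset_right) _ isOpen_ball
    (mem_ball_self hδ)
  have hqU := hU ⟨hqb, hqC⟩
  -- The face across the concave edge, on the inner side, is a deeper neighbour.
  let B := connectedComponentIn (⋃₀ circles x)ᶜ q
  have hB : IsFace x B := ⟨q, hqU, rfl⟩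
  have hqB : q ∈ B := mem_connectedComponentIn hqU
  have hpB : p ∈ closure B :=
    mem_closure_of_subset_ball hr hδ hp.1 ((hside B hB).1 ⟨q, ⟨hqb, hqC⟩, hqB⟩)
  have hBin : B ⊆ ball (midpoint ℝ (x i) (x j)) (dist (x i) (x j) / 2) :=
    (hB.subset_ball_or hC).resolve_right fun h => h hqB (ball_subset_closedBall hqC)
  have heB : IsEdgeOf x (connectedComponentIn (circle (x i) (x j) \ vertices x) p) B :=
    ⟨he.1.1, hB.edge_subset_frontier hx hC isPreconnected_connectedComponentIn
      (connectedComponentIn_subset _ _) hpe hpB⟩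
  have hne : A ≠ B := by
    intro h
    exact hAout (h ▸ hqB) (ball_subset_closedBall hqC)
  obtain ⟨a, ha⟩ := hA.nonempty
  exact lt_asymm (hdeep B ⟨hA, hB, hne, _, he.1, heB⟩ a ha q hqB)
    (depth_lt_depth hB hA hij hp hpB (frontier_subset_closure (he.1.2 hpe))
      (hBin.trans ball_subset_closedBall) hAout hqB ha)

end Gabriel

theorem mainTheorem11 {n : ℕ} (x : Fin n → Plane) (hx : Function.Injective x)
    (A : Set Plane) (hA : Gabriel.IsFace x A) :
    (Gabriel.IsLocallyDeepest x A ↔ ¬ ∃ e, Gabriel.IsConcaveEdgeOf x e A) ∧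
      (Gabriel.IsLocallyDeepest x A ↔ Convex ℝ A) := by
  have h : Gabriel.IsLocallyDeepest x A ↔ ¬ ∃ e, Gabriel.IsConcaveEdgeOf x e A :=
    ⟨fun h => h.not_exists_isConcaveEdgeOf hx hA,
      Gabriel.isLocallyDeepest_of_not_exists_isConcaveEdgeOf hx⟩
  exact ⟨h, h.trans ⟨Gabriel.convex_of_not_exists_isConcaveEdgeOf hx hA,
    Gabriel.not_exists_isConcaveEdgeOf_of_convex hx hA⟩⟩
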